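/- **Theorem (rate of state-assisted decoding with $q$ state bits).** Let $A,E,\beta,\gamma>0$, $N=\lceil\log_2(\gamma(A+2\beta))\rceil$, $Q(x)=\frac1{\sqrt{2\pi}}\int_x^\infty e^{-u^2/2}\,du$ and $\bar\epsilon=2Q(\beta)$. *Noise.* Let $Z$ be standard Gaussian, conditioned on $-\lceil\gamma A\rceil\le\gamma(Z+\beta)<\lceil\gamma(A+2\beta)\rceil$. Put $\hat Z=\gamma(Z+\beta)+2^N\mathbf 1\{\gamma(Z+\beta)<0\}$, $Z_i^b=\lfloor \hat Z/2^i\rfloor \bmod 2$ for $0\le i\le N-1$, and $Z_j^b=0$ for $j<0$. *Channel.* The vector binary channel with erasure probability $\epsilon$ has input $(X_0^b,\dots,X_{N-1}^b)\in\{0,1\}^N$. With probability $\epsilon$, independently of input and noise, the whole output is erased ($Y_i^c=\xi$ for all $i$). Otherwise $Y_i^c=Y_i^b=(X_i^b+Z_i^b+W_i^b)\bmod 2$, where $W_0^b=0$ and $W_{i}^b=(X_{i-1}^bZ_{i-1}^b+X_{i-1}^bW_{i-1}^b+Z_{i-1}^bW_{i-1}^b)\bmod 2$. The channel is memoryless,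 the noise is independent of the input, and the transmitted intensity is $X=\frac1\gamma\sum_i 2^iX_i^b$. *Scheme SD$_q$.* Let $1\le q\le N-1$ and, for each $i\in\{0,\dots,N-1\}$, let $\mathcal A_i\subseteq\{i-N+1,\dots,i-1\}$ with $|\mathcal A_i|=q$. Put $\boldsymbol S_i^b=(Z_a^b)_{a\in\mathcal A_i}$. The message is split into independent messages $m_0,\dots,m_{N-1}$, and $m_i$ is encoded separately into a binary codeword on bit-pipe $i$. The receiver decodes $m_0,m_1,\dots,m_{N-1}$ in this order. From its previous decisions it reconstructs, at unerased times, the noise bits of the lower bit-pipes and the carry-over $W_i^b$; it decodes $m_i$ only from the streams $\bar Y_i^c(t)$ (equal to $(Y_i^b(t)+W_i^b(t))\bmod 2$, or $\xi$ if erased) and $\boldsymbol S_i^c(t)$ (equal to $\boldsymbol S_i^b(t)$, or $\xi$ if erased). *Rate.* Let $\mathsf h$ be the binary entropy function in bits, $p\circledast a=p(1-a)+(1-p)a$ and $\alpha_i(\boldsymbol s)=\mathcal P\{Z_i^b=1\mid \boldsymbol S_i^b=\boldsymbol s\}$. Then $$R_{\mathrm{SD}_q}=(1-\bar\epsilon)\max_{(p_i)}\sum_{i=0}^{N-1}\mathbb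 E_{\boldsymbol S_i^b}\big[\mathsf h(p_i\circledast\alpha_i(\boldsymbol S_i^b))-\mathsf h(\alpha_i(\boldsymbol S_i^b))\big],$$ where the maximum is over all $p_0,\dots,p_{N-1}\in[0,1]$ with $\sum_{i:p_i\ne0}2^i\le\gamma A$ and $\sum_{i:p_i\neq 0}p_i2^i\le\gamma E$, exists, and is attained at some $(p_i)$ such that, for every erasure probability $\epsilon\in[0,\bar\epsilon]$, in particular for $\epsilon=\bar\epsilon$, SD$_q$ with bit probabilities $(p_i)$ achieves the rate $R_{\mathrm{SD}_q}$. That is, for every $\delta>0$ and all sufficiently large $n$ there is such a scheme of block length $n$, of rate at least $R_{\mathrm{SD}_q}-\delta$ bits per channel use, such that the probability that any $m_i$ is decoded wrongly is at most $\delta$ for every choice of the messages; the transmitted intensity always satisfies $0\le X(t)\le A$, and $\frac1n\sum_{t}X(t)\le E$ for every choice of the messages; the fraction of ones in every codeword of bit-pipe $i$ is within $\delta$ of $p_i$; and bit-pipes with $p_i=0$ send only zeros. -/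

import Mathlib

open MeasureTheory ProbabilityTheory Filter
open scoped ENNReal

/-- Gaussian tail function `Q(x)`. -/
noncomputable def gaussQ (x : ℝ) : ℝ :=
  1 / Real.sqrt (2 * Real.pi) * ∫ u in Set.Ioi x, Real.exp (-u ^ 2 / 2)

/-- Upper bound `2 Q(β)` on the erasure probability. -/
noncomputable def epsBar (β : ℝ) : ℝ := 2 * gaussQ β

/-- Number of bit-pipes, `⌈log₂ (γ (A + 2 β))⌉`. -/
noncomputable def numPipes (A β γ : ℝ) : ℕ := ⌈Real.logb 2 (γ * (A + 2 * β))⌉₊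

/-- Binary entropy in bits. -/
noncomputable def binEnt (p : ℝ) : ℝ := Real.binEntropy p / Real.log 2

/-- Binary convolution `p ⊛ a`. -/
def binConv (p a : ℝ) : ℝ := p * (1 - a) + (1 - p) * a

/-! ### The binary noise -/

/-- The nonnegative representative of the biased and scaled noise `γ (z + β)`:
two's complement is used for negative values. -/
noncomputable def zHat (N : ℕ) (β γ z : ℝ) : ℝ :=
  (if γ * (z + β) < 0 then (2 : ℝ) ^ N else 0) + γ * (z + β)

/-- The `N` noise bits of the real noise sample `z`, least significant bit first. -/
noncomputable def noiseBits (N : ℕ) (β γ z : ℝ) : Fin N → Bool :=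
  fun i => decide (⌊zHat N β γ z / (2 : ℝ) ^ (i : ℕ)⌋ % 2 = 1)

theorem measurable_noiseBits (N : ℕ) (β γ : ℝ) : Measurable (noiseBits N β γ) := by
  have hz : Measurable (zHat N β γ) := by
    unfold zHat
    refine Measurable.add (Measurable.ite ?_ measurable_const measurable_const) (by fun_prop)
    exact measurableSet_lt (by fun_prop) measurable_const
  refine measurable_pi_iff.2 fun i => ?_
  have h1 : Measurable fun z => ⌊zHat N β γ z / (2 : ℝ) ^ (i : ℕ)⌋ :=
    (hz.div_const _).floor
  exact (measurable_of_countable fun k : ℤ => decide (k % 2 = 1)).comp h1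

/-- The input-independent support of the noise given that there is no erasure:
`-⌈γ A⌉ ≤ γ (z + β) < ⌈γ (A + 2 β)⌉`. -/
def noiseSupport (A β γ : ℝ) : Set ℝ :=
  {z | -(⌈γ * A⌉ : ℝ) ≤ γ * (z + β) ∧ γ * (z + β) < (⌈γ * (A + 2 * β)⌉ : ℝ)}

/-- Joint law of the `N` noise bits: the standard Gaussian law, restricted to the support above and
normalized, is pushed forward to bits. -/
noncomputable def noiseLaw (A β γ : ℝ) : Measure (Fin (numPipes A β γ) → Bool) :=
  ((gaussianReal 0 1)[|noiseSupport A β γ]).map (noiseBits (numPipes A β γ) β γ)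

/-! ### The states and the rate expression -/

/-- The noise bit with integer index `j`; it is `0` outside `{0, …, N - 1}`. -/
def extBit {N : ℕ} (z : Fin N → Bool) (j : ℤ) : Bool :=
  if h : 0 ≤ j ∧ j < N then z ⟨j.toNat, by omega⟩ else false

/-- The state vector `(Z_a)_{a ∈ S}`. -/
def stateVec {N : ℕ} (S : Finset ℤ) (z : Fin N → Bool) : S → Bool := fun a => extBit z a

/-- `α_i(s) = P(Z_i = 1 | S_i = s)`. -/
noncomputable def alphaState (A β γ : ℝ) (S : Finset ℤ) (i : Fin (numPipes A β γ))
    (s : S → Bool) : ℝ :=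
  ((noiseLaw A β γ)[|{z | stateVec S z = s}]).real {z | z i = true}

/-- `∑_i E_{S_i} [h(p_i ⊛ α_i(S_i)) - h(α_i(S_i))]`. -/
noncomputable def sdSum (A β γ : ℝ) (𝒜 : Fin (numPipes A β γ) → Finset ℤ)
    (p : Fin (numPipes A β γ) → ℝ) : ℝ :=
  ∑ i, ∫ z, (binEnt (binConv (p i) (alphaState A β γ (𝒜 i) i (stateVec (𝒜 i) z)))
    - binEnt (alphaState A β γ (𝒜 i) i (stateVec (𝒜 i) z))) ∂(noiseLaw A β γ)

/-- The admissible `(p_i)`: the peak constraint is on the set of `on' bit-pipes (`p_i ≠ 0`). -/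
def feasibleInputs (A E β γ : ℝ) : Set (Fin (numPipes A β γ) → ℝ) :=
  {p | (∀ i, 0 ≤ p i ∧ p i ≤ 1) ∧
    (∑ i with p i ≠ 0, (2 : ℝ) ^ (i : ℕ)) ≤ γ * A ∧
    (∑ i with p i ≠ 0, p i * (2 : ℝ) ^ (i : ℕ)) ≤ γ * E}

/-! ### The vector binary channel with erasures -/

/-- Carry-over of the modulo-2 addition of three bits, `xz + xw + zw mod 2`. -/
def carryBit (x z w : Bool) : Bool := ((x && z) ^^ (x && w)) ^^ (z && w)

/-- The carry-over bit `W_k` entering bit-pipe `k`. -/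
def carryOver {N : ℕ} (x z : Fin N → Bool) : ℕ → Bool
  | 0 => false
  | k + 1 => if h : k < N then carryBit (x ⟨k, h⟩) (z ⟨k, h⟩) (carryOver x z k) else false

/-- Unerased output `Y_i = X_i + Z_i + W_i mod 2`. -/
def vbcOut {N : ℕ} (x z : Fin N → Bool) : Fin N → Bool :=
  fun i => (x i ^^ z i) ^^ carryOver x z i

/-- Output with erasures; an erasure (`none`, when `e = true`) hits all bit-pipes of one channel use
simultaneously. -/
def vbcErasedOut {N : ℕ} (x z : Fin N → Bool) (e : Bool) : Option (Fin N → Bool) :=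
  if e then none else some (vbcOut x z)

/-- Bernoulli law of the erasure indicator, with `P(true) = ε`. -/
noncomputable def erasureLaw (ε : ℝ) : Measure Bool :=
  ENNReal.ofReal ε • Measure.dirac true + ENNReal.ofReal (1 - ε) • Measure.dirac false

/-- Law of the noise bits and the erasure indicators in `n` independent channel uses. -/
noncomputable def blockLaw (A β γ ε : ℝ) (n : ℕ) :
    Measure (Fin n → (Fin (numPipes A β γ) → Bool) × Bool) :=
  Measure.pi fun _ => (noiseLaw A β γ).prod (erasureLaw ε)

/-! ### State-assisted decoding -/

/-- A state-assisted scheme of block length `n`: bit-pipe `i` has its own message set and its own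
encoder, and its decoder sees only the stream of carry-free outputs of bit-pipe `i` and the stream
of states `(Z_a)_{a ∈ 𝒜 i}`, both with erasures. -/
structure SDScheme {N : ℕ} (𝒜 : Fin N → Finset ℤ) (n : ℕ) where
  /-- number of messages of each bit-pipe -/
  M : Fin N → ℕ
  /-- encoders -/
  enc : ∀ i, Fin (M i) → Fin n → Bool
  /-- decoders -/
  dec : ∀ i, (Fin n → Option Bool) → (Fin n → Option (𝒜 i → Bool)) → Fin (M i)

namespace SDScheme

variable {N : ℕ} {𝒜 : Fin N → Finset ℤ} {n : ℕ}

/-- The binary vector that is sent at time `t`. -/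
def inputBits (c : SDScheme 𝒜 n) (m : ∀ i, Fin (c.M i)) (t : Fin n) : Fin N → Bool :=
  fun i => c.enc i (m i) t

/-- The intensity `X(t) = (1/γ) ∑_i X_i(t) 2^i` that is sent at time `t`. -/
noncomputable def intensity (c : SDScheme 𝒜 n) (γ : ℝ) (m : ∀ i, Fin (c.M i)) (t : Fin n) : ℝ :=
  (∑ i, if c.inputBits m t i then (2 : ℝ) ^ (i : ℕ) else 0) / γ

/-- The decision on the message of bit-pipe `i`, given the block `y` of channel outputs,
the receiver's reconstruction `z` of the noise bits of lower bit-pipes and its reconstruction `w`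
of the carry-over into bit-pipe `i`. -/
def decision (c : SDScheme 𝒜 n) (y : Fin n → Option (Fin N → Bool)) (i : Fin N)
    (z : Fin n → ℤ → Bool) (w : Fin n → Bool) : Fin (c.M i) :=
  c.dec i (fun t => (y t).map fun v => v i ^^ w t) (fun t => (y t).map fun _ a => z t a)

/-- What the receiver has reconstructed after it has decoded the bit-pipes below `k`: the noise bits
of these bit-pipes (all other bits are `0`) and the carry-over into bit-pipe `k`. The
reconstruction uses the decoded messages, so wrong decisions propagate. At erased times
the values are immaterial. -/
def receiver (c : SDScheme 𝒜 n) (y : Fin n → Option (Fin N → Bool)) :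
    ℕ → (Fin n → ℤ → Bool) × (Fin n → Bool)
  | 0 => (fun _ _ => false, fun _ => false)
  | k + 1 =>
    let z := (c.receiver y k).1
    let w := (c.receiver y k).2
    if h : k < N then
      let x : Fin n → Bool := c.enc ⟨k, h⟩ (c.decision y ⟨k, h⟩ z w)
      let zk : Fin n → Bool := fun t => (y t).elim false fun v => (v ⟨k, h⟩ ^^ w t) ^^ x t
      (fun t => Function.update (z t) k (zk t), fun t => carryBit (x t) (zk t) (w t))
    else (z, w)

/-- The decoded message of bit-pipe `i`. -/
def decoded (c : SDScheme 𝒜 n) (y : Fin n → Option (Fin N → Bool)) (i : Fin N) : Fin (c.M i) :=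
  c.decision y i (c.receiver y i).1 (c.receiver y i).2

/-- The block of channel outputs. -/
def output (c : SDScheme 𝒜 n) (m : ∀ i, Fin (c.M i)) (ω : Fin n → (Fin N → Bool) × Bool) :
    Fin n → Option (Fin N → Bool) :=
  fun t => vbcErasedOut (c.inputBits m t) (ω t).1 (ω t).2

end SDScheme

/-- Probability that some bit-pipe is decoded wrongly when the messages `m` are sent. -/
noncomputable def sdErrorProb (A β γ ε : ℝ) {𝒜 : Fin (numPipes A β γ) → Finset ℤ} {n : ℕ}
    (c : SDScheme 𝒜 n) (m : ∀ i, Fin (c.M i)) : ℝ :=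
  (blockLaw A β γ ε n).real {ω | ∃ i, c.decoded (c.output m ω) i ≠ m i}

/-- The scheme uses inputs with bit probabilities `p`, up to `δ`, and satisfies the
peak constraint `A` at all times and the average constraint `E` on every codeword. -/
def SDScheme.Admissible {N : ℕ} {𝒜 : Fin N → Finset ℤ} {n : ℕ} (c : SDScheme 𝒜 n)
    (A E γ : ℝ) (p : Fin N → ℝ) (δ : ℝ) : Prop :=
  (∀ i, p i = 0 → ∀ m t, c.enc i m t = false) ∧
  (∀ i m, |((Finset.univ.filter fun t => c.enc i m t = true).card : ℝ) / n - p i| ≤ δ) ∧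
  (∀ m t, c.intensity γ m t ≤ A) ∧
  (∀ m, (∑ t, c.intensity γ m t) / n ≤ E)

/-- The rate `R` (in bits per channel use) is achieved by state-assisted decoding with input
probabilities `p`: for all large block lengths there are schemes whose rate is at least `R - δ` and
whose maximal error probability is at most `δ`. -/
def SDAchieves (A E β γ ε : ℝ) (𝒜 : Fin (numPipes A β γ) → Finset ℤ)
    (p : Fin (numPipes A β γ) → ℝ) (R : ℝ) : Prop :=
  ∀ δ : ℝ, 0 < δ → ∀ᶠ n : ℕ in atTop, ∃ c : SDScheme 𝒜 n,
    c.Admissible A E γ p δ ∧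
    R - δ ≤ (∑ i, Real.logb 2 (c.M i)) / n ∧
    ∀ m, sdErrorProb A β γ ε c m ≤ δ

/-! Suppose a genie gives the receiver the true lower noise bits and carries. Bit-pipe `i` is then a
memoryless channel from `X_i` to the pair `(X_i + Z_i, S_i)`, or an erasure. Erasures carry no
information, and each state value `s` contributes a binary symmetric channel with crossover
`α_i(s)`. So the mutual information is `(1 - ε) E[h(p ⊛ α) - h(α)]` (`mutualInfo_pipeChannel`). If
the genie-aided decoder is right on every pipe, the real receiver makes the same decisions
(`decoded_eq`), because the states use only noise bits below `i`. A union bound over the pipes then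
suffices, and error propagation need not be followed.

The code of each pipe comes from Feinstein's greedy lemma, fed with Chebyshev estimates
(`eventually_exists_code`). It bounds the maximal error directly and lets codewords be confined to a
prescribed set, here those with nearly the right fraction of ones. Aiming at `p - τ` instead of `p`
keeps this fraction at most `p`, so the intensity constraints hold exactly
(`admissible_of_frequency_le`); continuity of the information bounds the loss of rate.

The maximum exists because the feasible set is compact, although `p i ≠ 0` is not a closed condition
(`isCompact_feasibleInputs`). The maximizer does not depend on `ε`. As the sum is nonnegative there,
the rate with `epsBar β` is at most the rate with any smaller `ε`. -/

/-! ### A weak law of large numbers for finite weights -/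

theorem sum_prod_weight_eq_one {A : Type*} [Fintype A] {w : A → ℝ} (hw1 : ∑ a, w a = 1) (n : ℕ) :
    ∑ v : Fin n → A, ∏ t, w (v t) = 1 := by
  classical
  have := Finset.prod_univ_sum (fun _ : Fin n => (Finset.univ : Finset A)) (fun _ a => w a)
  rw [Fintype.piFinset_univ] at this
  rw [← this]
  simp [hw1]

theorem sum_prod_weight_mul_sum {A : Type*} [Fintype A] {w : A → ℝ} (hw1 : ∑ a, w a = 1)
    {g : A → ℝ} (hg : ∑ a, w a * g a = 0) (n : ℕ) :
    ∑ v : Fin n → A, (∏ t, w (v t)) * ∑ t, g (v t) = 0 := by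
  induction n with
  | zero => simp
  | succ n ih =>
    rw [← (Fin.consEquiv fun _ : Fin (n + 1) => A).sum_comp, Fintype.sum_prod_type]
    have h : ∀ a : A, ∀ v : Fin n → A,
        (∏ t, w ((Fin.consEquiv fun _ : Fin (n + 1) => A) (a, v) t)) *
          ∑ t, g ((Fin.consEquiv fun _ : Fin (n + 1) => A) (a, v) t) =
        (w a * g a) * (∏ t, w (v t)) + w a * ((∏ t, w (v t)) * ∑ t, g (v t)) := by
      intro a v
      simp only [Fin.consEquiv_apply, Fin.prod_univ_succ, Fin.sum_univ_succ, Fin.cons_zero,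
        Fin.cons_succ]
      ring
    simp only [h, Finset.sum_add_distrib, ← Finset.mul_sum, ih, sum_prod_weight_eq_one hw1]
    simp [hg]

/-- Variances of independent centred variables add: after the first coordinate is split off, the
cross term vanishes because `g` has mean zero. -/
theorem sum_prod_weight_mul_sum_sq {A : Type*} [Fintype A] {w : A → ℝ} (hw1 : ∑ a, w a = 1)
    {g : A → ℝ} (hg : ∑ a, w a * g a = 0) (n : ℕ) :
    ∑ v : Fin n → A, (∏ t, w (v t)) * (∑ t, g (v t)) ^ 2 = n * ∑ a, w a * g a ^ 2 := by
  induction n with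
  | zero => simp
  | succ n ih =>
    rw [← (Fin.consEquiv fun _ : Fin (n + 1) => A).sum_comp, Fintype.sum_prod_type]
    have h : ∀ a : A, ∀ v : Fin n → A,
        (∏ t, w ((Fin.consEquiv fun _ : Fin (n + 1) => A) (a, v) t)) *
          (∑ t, g ((Fin.consEquiv fun _ : Fin (n + 1) => A) (a, v) t)) ^ 2 =
        (w a * g a ^ 2) * (∏ t, w (v t)) + (2 * (w a * g a)) * ((∏ t, w (v t)) * ∑ t, g (v t)) +
          w a * ((∏ t, w (v t)) * (∑ t, g (v t)) ^ 2) := by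
      intro a v
      simp only [Fin.consEquiv_apply, Fin.prod_univ_succ, Fin.sum_univ_succ, Fin.cons_zero,
        Fin.cons_succ]
      ring
    simp only [h, Finset.sum_add_distrib, ← Finset.mul_sum, ih, sum_prod_weight_eq_one hw1,
      sum_prod_weight_mul_sum hw1 hg, ← Finset.sum_mul, hw1]
    push_cast
    ring

open Classical in
/-- Chebyshev's form of the weak law of large numbers for finite weights. -/
theorem eventually_sum_prod_weight_deviation_le {A : Type*} [Fintype A] {w : A → ℝ}
    (hw : ∀ a, 0 ≤ w a) (hw1 : ∑ a, w a = 1) (f : A → ℝ) {δ η : ℝ} (hδ : 0 < δ) (hη : 0 < η) :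
    ∀ᶠ n : ℕ in atTop,
      ∑ v : Fin n → A with n * δ ≤ |∑ t, f (v t) - n * ∑ a, w a * f a|, ∏ t, w (v t) ≤ η := by
  set m := ∑ a, w a * f a with hm
  set V := ∑ a, w a * (f a - m) ^ 2 with hV
  have hg : ∑ a, w a * (f a - m) = 0 := by
    simp only [mul_sub, Finset.sum_sub_distrib, ← Finset.sum_mul, hw1, ← hm]; ring
  -- Chebyshev's bound is `V / (n δ ^ 2)`; this makes it at most `η`.
  obtain ⟨n₀, hn₀⟩ := exists_nat_gt (V / (δ ^ 2 * η))
  filter_upwards [eventually_ge_atTop (max n₀ 1)] with n hn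
  have hn1 : (1 : ℝ) ≤ n := by exact_mod_cast (le_max_right _ _).trans hn
  have hnV : V / (δ ^ 2 * η) ≤ n := hn₀.le.trans (by exact_mod_cast (le_max_left _ _).trans hn)
  have hw' : ∀ v : Fin n → A, 0 ≤ ∏ t, w (v t) := fun v => Finset.prod_nonneg fun _ _ => hw _
  have hsum : ∀ v : Fin n → A, ∑ t, (f (v t) - m) = ∑ t, f (v t) - n * m := by
    intro v; simp [Finset.sum_sub_distrib]
  have h1 : (n * δ) ^ 2 * ∑ v : Fin n → A with n * δ ≤ |∑ t, f (v t) - n * m|, ∏ t, w (v t)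
      ≤ n * V := by
    rw [hV, ← sum_prod_weight_mul_sum_sq hw1 hg n, Finset.mul_sum]
    refine (Finset.sum_le_sum fun v hv => ?_).trans
      (Finset.sum_le_sum_of_subset_of_nonneg (Finset.filter_subset _ _)
        fun v _ _ => mul_nonneg (hw' v) (sq_nonneg _))
    rw [hsum, mul_comm]
    refine mul_le_mul_of_nonneg_left ?_ (hw' v)
    rw [← sq_abs (∑ t, f (v t) - n * m)]
    exact pow_le_pow_left₀ (by positivity) (Finset.mem_filter.1 hv).2 2
  rw [div_le_iff₀ (by positivity)] at hnV
  have h2 : (n * δ) ^ 2 * ∑ v : Fin n → A with n * δ ≤ |∑ t, f (v t) - n * m|, ∏ t, w (v t)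
      ≤ (n * δ) ^ 2 * η := by
    refine h1.trans ?_
    have : (n : ℝ) * V ≤ n * (n * (δ ^ 2 * η)) := mul_le_mul_of_nonneg_left hnV (by positivity)
    linarith [this]
  exact le_of_mul_le_mul_left h2 (by positivity)

/-! ### Feinstein's lemma -/

open Classical in
/-- Feinstein's greedy construction of a code with codewords in `F` and small maximal error. -/
theorem exists_decoding_sets {X Y : Type*} [Fintype X] [Fintype Y]
    {P : X → ℝ} (hP : ∀ x, 0 ≤ P x) (hP1 : ∑ x, P x = 1)
    {W : X → Y → ℝ} (hW : ∀ x y, 0 ≤ W x y) (hW1 : ∀ x, ∑ y, W x y = 1)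
    (F : Set X) {K η : ℝ} (hK : 0 < K) (hη : η ≤ 1)
    (hF : ∑ x with x ∉ F, P x ≤ η / 4)
    (hB : ∑ x, ∑ y with W x y ≤ K * ∑ x', P x' * W x' y, P x * W x y ≤ η / 4)
    (M : ℕ) (hM : (M : ℝ) < η / 2 * K + 1) :
    ∃ (c : ℕ → X) (D : ℕ → Finset Y), ∀ j < M, c j ∈ F ∧
      (∀ y ∈ D j, K * ∑ x', P x' * W x' y ≤ W (c j) y) ∧
      (1 - η ≤ ∑ y ∈ D j, W (c j) y) ∧ ∀ k < M, k ≠ j → Disjoint (D k) (D j) := by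
  induction M with
  | zero =>
    have : Nonempty X := by
      by_contra h
      rw [not_nonempty_iff] at h
      simp at hP1
    exact ⟨fun _ => Classical.arbitrary X, fun _ => ∅, by simp⟩
  | succ M ih =>
    push_cast at hM
    obtain ⟨c, D, h⟩ := ih (by linarith)
    set Q : Y → ℝ := fun y => ∑ x', P x' * W x' y with hQ
    have hQ0 : ∀ y, 0 ≤ Q y := fun y => Finset.sum_nonneg fun x _ => mul_nonneg (hP x) (hW x y)
    set U : Finset Y := (Finset.range M).biUnion D with hU
    -- The decoding sets are disjoint, and each satisfies `K * Q (D j) ≤ W (c j) (D j) ≤ 1`.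
    have hUK : K * ∑ y ∈ U, Q y ≤ M := by
      have h1 : ∑ y ∈ U, Q y ≤ ∑ j ∈ Finset.range M, ∑ y ∈ D j, Q y := by
        rw [hU]
        refine (Finset.sum_biUnion fun j hj k hk hjk => ?_).le
        exact (h k (Finset.mem_range.1 hk)).2.2.2 j (Finset.mem_range.1 hj) hjk
      calc K * ∑ y ∈ U, Q y ≤ K * ∑ j ∈ Finset.range M, ∑ y ∈ D j, Q y :=
            mul_le_mul_of_nonneg_left h1 hK.le
        _ = ∑ j ∈ Finset.range M, ∑ y ∈ D j, K * Q y := by simp only [Finset.mul_sum]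
        _ ≤ ∑ j ∈ Finset.range M, (1 : ℝ) := by
            refine Finset.sum_le_sum fun j hj => ?_
            rw [← hW1 (c j)]
            refine (Finset.sum_le_sum (h j (Finset.mem_range.1 hj)).2.1).trans ?_
            exact Finset.sum_le_sum_of_subset_of_nonneg (Finset.subset_univ _) fun y _ _ => hW _ y
        _ = M := by simp
    have hUη : ∑ y ∈ U, Q y < η / 2 := by
      have : K * ∑ y ∈ U, Q y < K * (η / 2) := by linarith
      exact lt_of_mul_lt_mul_left this hK.le

    -- If no word of `F` could be added, averaging over `P` would give `1 ≤ η/4 + Q(U) + (1 - η) + η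
    -- * P(Fᶜ)`. This is less than `1`, since `Q(U) < η/2` and `P(Fᶜ) ≤ η/4`.
    obtain ⟨x, hxF, hx⟩ : ∃ x ∈ F,
        1 - η ≤ ∑ y with K * Q y < W x y ∧ y ∉ U, W x y := by
      by_contra hcon
      push Not at hcon
      have hsplit : ∀ x, 1 ≤ ∑ y with W x y ≤ K * Q y, W x y + ∑ y ∈ U, W x y +
          ∑ y with K * Q y < W x y ∧ y ∉ U, W x y := by
        intro x
        have hU' : ∑ y ∈ U, W x y = ∑ y, if y ∈ U then W x y else 0 := by simp
        rw [← hW1 x, Finset.sum_filter, Finset.sum_filter, hU',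
          ← Finset.sum_add_distrib, ← Finset.sum_add_distrib]
        refine Finset.sum_le_sum fun y _ => ?_
        have := hW x y
        by_cases h1 : W x y ≤ K * Q y
        · by_cases h2 : y ∈ U <;> simp [h1, h2, this, not_lt.2 h1]
        · by_cases h2 : y ∈ U <;> simp [h1, h2, not_le.1 h1]
      have hg : ∀ x, ∑ y with K * Q y < W x y ∧ y ∉ U, W x y ≤ (1 - η) + if x ∉ F then η else 0 := by
        intro x
        by_cases hx : x ∈ F
        · simpa [hx] using (hcon x hx).le
        · rw [if_pos hx, sub_add_cancel, ← hW1 x]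
          exact Finset.sum_le_sum_of_subset_of_nonneg (Finset.subset_univ _) fun y _ _ => hW x y
      have hQU : ∑ x, P x * ∑ y ∈ U, W x y = ∑ y ∈ U, Q y := by
        simp only [hQ, Finset.mul_sum]
        exact Finset.sum_comm
      have hη0 : 0 ≤ η := by
        have : 0 ≤ ∑ x with x ∉ F, P x := Finset.sum_nonneg fun x _ => hP x
        linarith
      have h1 : (1 : ℝ) ≤ ∑ x, (P x * ∑ y with W x y ≤ K * Q y, W x y + P x * ∑ y ∈ U, W x y +
          (P x * (1 - η) + η * if x ∉ F then P x else 0)) := by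
        refine hP1.symm.le.trans (Finset.sum_le_sum fun x _ => ?_)
        have h2 := mul_le_mul_of_nonneg_left ((hsplit x).trans (add_le_add_right (hg x) _)) (hP x)
        have h3 : P x * (if x ∉ F then η else 0) = η * if x ∉ F then P x else 0 := by
          split_ifs <;> ring
        rw [mul_add, mul_add, mul_add, h3] at h2
        linarith
      simp only [Finset.sum_add_distrib, hQU, ← Finset.sum_mul, ← Finset.mul_sum, hP1,
        ← Finset.sum_filter] at h1
      have h4 : ∑ x, P x * ∑ y with W x y ≤ K * Q y, W x y ≤ η / 4 := by
        refine le_of_eq_of_le (Finset.sum_congr rfl fun x _ => ?_) hB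
        exact Finset.mul_sum _ _ _
      have h5 : η * ∑ x with x ∉ F, P x ≤ 1 * (η / 4) :=
        mul_le_mul hη hF (Finset.sum_nonneg fun x _ => hP x) zero_le_one
      linarith
    have hdisj : ∀ j < M, Disjoint (D j) ({y | K * Q y < W x y ∧ y ∉ U} : Finset Y) := by
      intro j hj
      refine Finset.disjoint_left.2 fun y hy hy' => (Finset.mem_filter.1 hy').2.2 ?_
      exact Finset.mem_biUnion.2 ⟨j, Finset.mem_range.2 hj, hy⟩
    refine ⟨Function.update c M x, Function.update D M
      (Finset.univ.filter fun y => K * Q y < W x y ∧ y ∉ U),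
      fun j hj => ?_⟩
    rcases (Nat.lt_succ_iff.1 hj).eq_or_lt with rfl | hj'
    · refine ⟨by simpa using hxF, fun y hy => ?_, by simpa using hx, fun k hk hkj => ?_⟩
      · simp only [Function.update_self] at hy ⊢
        exact (Finset.mem_filter.1 hy).2.1.le
      · simpa [Function.update_of_ne hkj] using hdisj k (by omega)
    · rw [Function.update_of_ne hj'.ne, Function.update_of_ne hj'.ne]
      refine ⟨(h j hj').1, (h j hj').2.1, (h j hj').2.2.1, fun k hk hkj => ?_⟩
      rcases (Nat.lt_succ_iff.1 hk).eq_or_lt with rfl | hk'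
      · simpa using (hdisj j hj').symm
      · rw [Function.update_of_ne hk'.ne]
        exact (h j hj').2.2.2 k hk' hkj

open Classical in
/-- Feinstein's lemma: the size of the code is at least `K η / 2`. -/
theorem exists_code_of_likelihood_ratio {X Y : Type*} [Fintype X] [Fintype Y]
    {P : X → ℝ} (hP : ∀ x, 0 ≤ P x) (hP1 : ∑ x, P x = 1)
    {W : X → Y → ℝ} (hW : ∀ x y, 0 ≤ W x y) (hW1 : ∀ x, ∑ y, W x y = 1)
    (F : Set X) {K η : ℝ} (hK : 0 < K) (hη0 : 0 < η) (hη : η ≤ 1)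
    (hF : ∑ x with x ∉ F, P x ≤ η / 4)
    (hB : ∑ x, ∑ y with W x y ≤ K * ∑ x', P x' * W x' y, P x * W x y ≤ η / 4) :
    ∃ M : ℕ, 0 < M ∧ η / 2 * K ≤ M ∧ ∃ (c : Fin M → X) (D : Y → Fin M),
      ∀ j, c j ∈ F ∧ ∑ y with D y ≠ j, W (c j) y ≤ η := by
  have hpos : 0 < η / 2 * K := by positivity
  -- The greedy step stays possible as long as `M < η / 2 * K + 1`, so the ceiling is reached.
  set M := ⌈η / 2 * K⌉₊ with hM
  have hM0 : 0 < M := Nat.ceil_pos.2 hpos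
  obtain ⟨c, D, h⟩ := exists_decoding_sets hP hP1 hW hW1 F hK hη hF hB M
    (Nat.ceil_lt_add_one hpos.le)
  refine ⟨M, hM0, Nat.le_ceil _, fun j => c j,
    -- Outputs outside all decoding sets get an arbitrary decision; they already count as errors in
    -- the bound.
    fun y => if hy : ∃ j : Fin M, y ∈ D j then hy.choose else ⟨0, hM0⟩, fun j => ⟨(h j j.2).1, ?_⟩⟩
  have hdec : ∀ y ∈ D j, (if hy : ∃ j : Fin M, y ∈ D j then hy.choose else ⟨0, hM0⟩) = j := by
    intro y hy
    have hex : ∃ j : Fin M, y ∈ D j := ⟨j, hy⟩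
    rw [dif_pos hex]
    by_contra hne
    refine Finset.disjoint_left.1 ((h j j.2).2.2.2 hex.choose hex.choose.2 ?_) hex.choose_spec hy
    exact fun h => hne (Fin.ext h)
  have h1 := (h j j.2).2.2.1
  have h2 : ∑ y with (if hy : ∃ j : Fin M, y ∈ D j then hy.choose else ⟨0, hM0⟩) ≠ j, W (c j) y
      + ∑ y ∈ D j, W (c j) y ≤ 1 := by
    rw [← hW1 (c j), ← Finset.sum_union]
    · exact Finset.sum_le_sum_of_subset_of_nonneg (Finset.subset_univ _) fun y _ _ => hW _ y
    · exact Finset.disjoint_left.2 fun y hy hy' => (Finset.mem_filter.1 hy).2 (hdec y hy')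
  linarith

/-! ### Codes for discrete memoryless channels -/

/-- Mutual information, in nats, of the channel `W` with input weights `P`. -/
noncomputable def mutualInfo {X Y : Type*} [Fintype X] [Fintype Y] (P : X → ℝ) (W : X → Y → ℝ) :
    ℝ :=
  ∑ x, ∑ y, P x * W x y * Real.log (W x y / ∑ x', P x' * W x' y)

theorem sum_prod_mul_prod {X Y : Type*} [Fintype X] (P : X → ℝ) (W : X → Y → ℝ) {n : ℕ}
    (y : Fin n → Y) :
    ∑ x : Fin n → X, (∏ t, P (x t)) * ∏ t, W (x t) (y t) = ∏ t, ∑ x, P x * W x (y t) := by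
  classical
  rw [Finset.prod_univ_sum, Fintype.piFinset_univ]
  simp only [Finset.prod_mul_distrib]

open Classical in
/-- Achievability for a discrete memoryless channel, with the maximal error probability and with
codewords whose empirical mean of `f` is close to the mean of `f` under the input weights. -/
theorem eventually_exists_code {X Y : Type*} [Fintype X] [Fintype Y]
    {P : X → ℝ} (hP : ∀ x, 0 ≤ P x) (hP1 : ∑ x, P x = 1)
    {W : X → Y → ℝ} (hW : ∀ x y, 0 ≤ W x y) (hW1 : ∀ x, ∑ y, W x y = 1)
    (f : X → ℝ) {δ : ℝ} (hδ : 0 < δ) :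
    ∀ᶠ n : ℕ in atTop, ∃ M : ℕ, 0 < M ∧ n * (mutualInfo P W - δ) ≤ Real.log M ∧
      ∃ (c : Fin M → Fin n → X) (D : (Fin n → Y) → Fin M), ∀ j,
        |∑ t, f (c j t) - n * ∑ x, P x * f x| < n * δ ∧
        ∑ y with D y ≠ j, ∏ t, W (c j t) (y t) ≤ δ := by
  set η := min δ 1 with hη
  have hη0 : 0 < η := lt_min hδ one_pos
  set Q : Y → ℝ := fun y => ∑ x, P x * W x y with hQ
  have hQ0 : ∀ y, 0 ≤ Q y := fun y => Finset.sum_nonneg fun x _ => mul_nonneg (hP x) (hW x y)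
  set w : X × Y → ℝ := fun a => P a.1 * W a.1 a.2 with hw
  have hw0 : ∀ a, 0 ≤ w a := fun a => mul_nonneg (hP _) (hW _ _)
  have hw1 : ∑ a, w a = 1 := by
    rw [Fintype.sum_prod_type]
    simp only [hw, ← Finset.mul_sum, hW1, mul_one, hP1]
  set L : X × Y → ℝ := fun a => Real.log (W a.1 a.2 / Q a.2) with hL
  have hI : ∑ a, w a * L a = mutualInfo P W := by
    rw [Fintype.sum_prod_type]; rfl
  have hlarge : ∀ᶠ n : ℕ in atTop, -Real.log (η / 2) ≤ n * (δ / 2) := by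
    have := (tendsto_natCast_atTop_atTop (R := ℝ)).atTop_mul_const (half_pos hδ)
    exact this.eventually_ge_atTop _
  filter_upwards [hlarge,
    eventually_sum_prod_weight_deviation_le hP hP1 f hδ (show 0 < η / 4 by positivity),
    eventually_sum_prod_weight_deviation_le hw0 hw1 L (half_pos hδ) (show 0 < η / 4 by positivity)]
    with n hn hnf hnL
  rw [hI] at hnL
  -- Half of `δ` keeps the threshold below the typical likelihood ratio; the other half absorbs `log
  -- (η / 2)` in the size of the code.
  set K := Real.exp (n * (mutualInfo P W - δ / 2)) with hK
  obtain ⟨M, hM0, hM, c, D, hc⟩ := exists_code_of_likelihood_ratio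
    (P := fun x : Fin n → X => ∏ t, P (x t)) (fun x => Finset.prod_nonneg fun _ _ => hP _)
    (sum_prod_weight_eq_one hP1 n)
    (W := fun (x : Fin n → X) (y : Fin n → Y) => ∏ t, W (x t) (y t))
    (fun x y => Finset.prod_nonneg fun _ _ => hW _ _)
    (fun x => by
      have := Finset.prod_univ_sum (fun _ : Fin n => (Finset.univ : Finset Y))
        (fun t y => W (x t) y)
      rw [Fintype.piFinset_univ] at this
      rw [← this]
      simp [hW1])
    {x | |∑ t, f (x t) - n * ∑ x, P x * f x| < n * δ} (Real.exp_pos _ : 0 < K) hη0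
    (min_le_right _ _) (by simpa only [Set.mem_ofPred_eq, not_lt] using hnf) (by
      simp only [sum_prod_mul_prod]
      refine le_trans ?_ hnL
      simp only [Finset.sum_filter]
      -- A pair of sequences becomes a sequence of pairs, to which the weak law for the joint weight
      -- `w` applies.
      rw [← Fintype.sum_prod_type',
        ← (Equiv.arrowProdEquivProdArrow (Fin n) (fun _ => X) (fun _ => Y)).symm.sum_comp]
      refine Finset.sum_le_sum fun a _ => ?_
      obtain ⟨x, y⟩ := a
      have hwxy : ∏ t, w (x t, y t) = (∏ t, P (x t)) * ∏ t, W (x t) (y t) :=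
        Finset.prod_mul_distrib
      have hw0' : 0 ≤ ∏ t, w (x t, y t) := Finset.prod_nonneg fun _ _ => hw0 _
      simp only [Equiv.arrowProdEquivProdArrow_symm_apply]
      rw [hwxy] at hw0' ⊢
      -- Off the null pairs all factors are positive, so the logarithm of the likelihood ratio is
      -- the sum of the `L (x t, y t)`.
      by_cases h0 : (∏ t, P (x t)) * ∏ t, W (x t) (y t) = 0
      · simp [h0]
      by_cases h1 : ∏ t, W (x t) (y t) ≤
          Real.exp (n * (mutualInfo P W - δ / 2)) * ∏ t, ∑ x, P x * W x (y t)
      · rw [if_pos h1, if_pos]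
        have hpos : ∀ t, 0 < P (x t) ∧ 0 < W (x t) (y t) := fun t =>
          ⟨(hP _).lt_of_ne' (Finset.prod_ne_zero_iff.1 (mul_ne_zero_iff.1 h0).1 t (by simp)),
            (hW _ _).lt_of_ne' (Finset.prod_ne_zero_iff.1 (mul_ne_zero_iff.1 h0).2 t (by simp))⟩
        have hQpos : ∀ t, 0 < Q (y t) := fun t =>
          (mul_pos (hpos t).1 (hpos t).2).trans_le
            (Finset.single_le_sum (f := fun x => P x * W x (y t))
              (fun x _ => mul_nonneg (hP x) (hW x _)) (Finset.mem_univ (x t)))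
        have hQn : 0 < ∏ t, Q (y t) := Finset.prod_pos fun t _ => hQpos t
        have hWn : 0 < ∏ t, W (x t) (y t) := Finset.prod_pos fun t _ => (hpos t).2
        have hlog : ∑ t, L (x t, y t) = Real.log ((∏ t, W (x t) (y t)) / ∏ t, Q (y t)) := by
          rw [← Finset.prod_div_distrib, Real.log_prod]
          exact fun t _ => (div_pos (hpos t).2 (hQpos t)).ne'
        have h2 : ∑ t, L (x t, y t) ≤ n * (mutualInfo P W - δ / 2) := by
          rw [hlog, Real.log_le_iff_le_exp (div_pos hWn hQn), div_le_iff₀ hQn]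
          exact h1
        rw [le_abs]
        right
        linarith
      · rw [if_neg h1]
        split_ifs <;> simp [hw0'])
  refine ⟨M, hM0, ?_, c, D, fun j => ⟨(hc j).1, (hc j).2.trans (min_le_left _ _)⟩⟩
  have h1 := Real.log_le_log (by positivity) hM
  rw [Real.log_mul (by positivity) (by positivity), Real.log_exp] at h1
  linarith

/-! ### A single bit-pipe with state at the receiver and erasures -/

/-- The bound on `k * v` rules out `d = 0` unless the whole term vanishes, so degenerate
probabilities need no separate treatment. -/
theorem mul_log_div_of_le {v d k : ℝ} (hk : 0 ≤ k) (hv : 0 ≤ v) (h : k * v ≤ d) :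
    k * v * Real.log (v / d) = k * v * (Real.log v - Real.log d) := by
  by_cases h0 : k * v = 0
  · simp [h0]
  have hkv : 0 < k * v := (mul_nonneg hk hv).lt_of_ne' h0
  rw [Real.log_div (right_ne_zero_of_mul h0) (hkv.trans_le h).ne']

theorem binary_information_terms {p a : ℝ} (hp0 : 0 ≤ p) (hp1 : p ≤ 1) (ha0 : 0 ≤ a)
    (ha1 : a ≤ 1) :
    p * (1 - a) * Real.log ((1 - a) / binConv p a) + p * a * Real.log (a / (1 - binConv p a)) +
      ((1 - p) * a * Real.log (a / binConv p a) +
        (1 - p) * (1 - a) * Real.log ((1 - a) / (1 - binConv p a))) =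
    Real.binEntropy (binConv p a) - Real.binEntropy a := by
  have hp1' : 0 ≤ 1 - p := sub_nonneg.2 hp1
  have ha1' : 0 ≤ 1 - a := sub_nonneg.2 ha1
  have h1 := mul_nonneg hp0 ha0
  have h2 := mul_nonneg hp0 ha1'
  have h3 := mul_nonneg hp1' ha0
  have h4 := mul_nonneg hp1' ha1'
  rw [mul_log_div_of_le hp0 ha1' (by unfold binConv; linarith),
    mul_log_div_of_le hp0 ha0 (by unfold binConv; linarith),
    mul_log_div_of_le hp1' ha0 (by unfold binConv; linarith),
    mul_log_div_of_le hp1' ha1' (by unfold binConv; linarith),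
    Real.binEntropy_eq_negMulLog_add_negMulLog_one_sub,
    Real.binEntropy_eq_negMulLog_add_negMulLog_one_sub]
  simp only [Real.negMulLog]
  have hu : binConv p a = p * (1 - a) + (1 - p) * a := rfl
  linear_combination (Real.log (1 - binConv p a) - Real.log (binConv p a)) * (-hu)

/-- The contribution of one state value: `r₀` and `r₁` are its joint probabilities with noise bit
`0` and `1`, and `k` will be `1 - ε`. The common factor `k * (r₀ + r₁)` cancels inside every
logarithm. -/
theorem scaled_binary_information_terms {p k r₀ r₁ : ℝ} (hp0 : 0 ≤ p) (hp1 : p ≤ 1)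
    (h0 : 0 ≤ r₀) (h1 : 0 ≤ r₁) :
    p * (k * r₀) * Real.log (k * r₀ / (p * (k * r₀) + (1 - p) * (k * r₁))) +
      p * (k * r₁) * Real.log (k * r₁ / (p * (k * r₁) + (1 - p) * (k * r₀))) +
      ((1 - p) * (k * r₁) * Real.log (k * r₁ / (p * (k * r₀) + (1 - p) * (k * r₁))) +
        (1 - p) * (k * r₀) * Real.log (k * r₀ / (p * (k * r₁) + (1 - p) * (k * r₀)))) =
    k * ((r₀ + r₁) * (Real.binEntropy (binConv p (r₁ / (r₀ + r₁))) -
      Real.binEntropy (r₁ / (r₀ + r₁)))) := by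
  by_cases hk : k = 0
  · simp [hk]
  rcases (add_nonneg h0 h1).eq_or_lt with hR | hR
  · obtain rfl : r₀ = 0 := by linarith
    obtain rfl : r₁ = 0 := by linarith
    simp
  set R := r₀ + r₁ with hRdef
  set a := r₁ / R with ha
  have hr₁ : r₁ = R * a := by rw [ha]; field_simp
  have hr₀ : r₀ = R * (1 - a) := by rw [mul_sub, ← hr₁, hRdef]; ring
  have ha0 : 0 ≤ a := by positivity
  have ha1 : a ≤ 1 := by rw [ha, div_le_one hR]; linarith
  rw [← binary_information_terms hp0 hp1 ha0 ha1, hr₀, hr₁]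
  have hkR : k * R ≠ 0 := mul_ne_zero hk hR.ne'
  have e1 : p * (k * (R * (1 - a))) + (1 - p) * (k * (R * a)) = k * R * binConv p a := by
    unfold binConv; ring
  have e2 : p * (k * (R * a)) + (1 - p) * (k * (R * (1 - a))) = k * R * (1 - binConv p a) := by
    unfold binConv; ring
  rw [e1, e2, ← mul_assoc k R, ← mul_assoc k R, mul_div_mul_left _ _ hkR,
    mul_div_mul_left _ _ hkR, mul_div_mul_left _ _ hkR, mul_div_mul_left _ _ hkR]
  ring

/-- Weights of a bit that is `true` with probability `p`. -/
def bernWeight (p : ℝ) (x : Bool) : ℝ := if x then p else 1 - p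

theorem isProbabilityMeasure_erasureLaw {ε : ℝ} (h0 : 0 ≤ ε) (h1 : ε ≤ 1) :
    IsProbabilityMeasure (erasureLaw ε) := by
  refine ⟨?_⟩
  simp [erasureLaw, ← ENNReal.ofReal_add h0 (sub_nonneg.2 h1)]

theorem erasureLaw_real_true {ε : ℝ} (h0 : 0 ≤ ε) : (erasureLaw ε).real {true} = ε := by
  simp [erasureLaw, measureReal_def, h0]

theorem erasureLaw_real_false {ε : ℝ} (h1 : ε ≤ 1) : (erasureLaw ε).real {false} = 1 - ε := by
  simp [erasureLaw, measureReal_def, h1]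

section Pipe

variable {Z S : Type*}

/-- Output of a bit-pipe with input `x`: the noisy bit and the state, unless there is an erasure. -/
def pipeOut (b : Z → Bool) (σ : Z → S) (x : Bool) (ω : Z × Bool) : Option (Bool × S) :=
  if ω.2 then none else some (x ^^ b ω.1, σ ω.1)

variable [MeasurableSpace Z]

/-- Transition probabilities of a bit-pipe. -/
noncomputable def pipeChannel (ν : Measure Z) (ε : ℝ) (b : Z → Bool) (σ : Z → S) (x : Bool)
    (y : Option (Bool × S)) : ℝ :=
  (ν.prod (erasureLaw ε)).real {ω | pipeOut b σ x ω = y}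

/-- Mutual information in bits of a bit-pipe without erasures. -/
noncomputable def pipeInfo (ν : Measure Z) (b : Z → Bool) (σ : Z → S) (p : ℝ) : ℝ :=
  ∫ z, (binEnt (binConv p ((ν[|{z' | σ z' = σ z}]).real {z' | b z' = true}))
    - binEnt ((ν[|{z' | σ z' = σ z}]).real {z' | b z' = true})) ∂ν

theorem pipeChannel_none {ν : Measure Z} [IsProbabilityMeasure ν] {ε : ℝ} (h0 : 0 ≤ ε)
    (h1 : ε ≤ 1) (b : Z → Bool) (σ : Z → S) (x : Bool) : pipeChannel ν ε b σ x none = ε := by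
  have := isProbabilityMeasure_erasureLaw h0 h1
  have : {ω : Z × Bool | pipeOut b σ x ω = none} = Set.univ ×ˢ {true} := by
    ext ⟨z, e⟩; cases e <;> simp [pipeOut]
  rw [pipeChannel, this, measureReal_prod_prod, erasureLaw_real_true h0]
  simp

theorem pipeChannel_some {ν : Measure Z} [IsProbabilityMeasure ν] {ε : ℝ} (h0 : 0 ≤ ε)
    (h1 : ε ≤ 1) (b : Z → Bool) (σ : Z → S) (x c : Bool) (s : S) :
    pipeChannel ν ε b σ x (some (c, s)) = (1 - ε) * ν.real {z | σ z = s ∧ b z = (x ^^ c)} := by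
  have := isProbabilityMeasure_erasureLaw h0 h1
  have : {ω : Z × Bool | pipeOut b σ x ω = some (c, s)} =
      {z | σ z = s ∧ b z = (x ^^ c)} ×ˢ {false} := by
    ext ⟨z, e⟩
    have : (x ^^ b z) = c ↔ b z = (x ^^ c) := by cases x <;> cases b z <;> cases c <;> simp
    cases e <;> simp [pipeOut, this, and_comm]
  rw [pipeChannel, this, measureReal_prod_prod, erasureLaw_real_false h1, mul_comm]

variable [DiscreteMeasurableSpace Z]

theorem sum_pipeChannel [Fintype Z] [Fintype S] (ν : Measure Z) [IsProbabilityMeasure ν] {ε : ℝ} (h0 : 0 ≤ ε)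
    (h1 : ε ≤ 1) (b : Z → Bool) (σ : Z → S) (x : Bool) : ∑ y, pipeChannel ν ε b σ x y = 1 := by
  have := isProbabilityMeasure_erasureLaw h0 h1
  have h := sum_measureReal_preimage_singleton (μ := ν.prod (erasureLaw ε)) Finset.univ
    (f := pipeOut b σ x) (fun _ _ => MeasurableSet.of_discrete)
  rw [Finset.coe_univ, Set.preimage_univ, probReal_univ] at h
  exact h

theorem integral_comp_eq_sum [Fintype S] [MeasurableSpace S]
    [DiscreteMeasurableSpace S] (ν : Measure Z) [IsProbabilityMeasure ν] (σ : Z → S) (φ : S → ℝ) :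
    ∫ z, φ (σ z) ∂ν = ∑ s, ν.real {z | σ z = s} * φ s := by
  rw [← integral_map (f := φ) (φ := σ) (Measurable.of_discrete).aemeasurable
    (Measurable.of_discrete).aestronglyMeasurable, integral_fintype Integrable.of_finite]
  refine Finset.sum_congr rfl fun s _ => ?_
  rw [map_measureReal_apply Measurable.of_discrete MeasurableSet.of_discrete, smul_eq_mul]
  rfl

theorem mutualInfo_pipeChannel [Fintype Z] [Fintype S] [MeasurableSpace S]
    [DiscreteMeasurableSpace S] (ν : Measure Z) [IsProbabilityMeasure ν] {ε : ℝ} (h0 : 0 ≤ ε)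
    (h1 : ε ≤ 1) (b : Z → Bool) (σ : Z → S) {p : ℝ} (hp0 : 0 ≤ p) (hp1 : p ≤ 1) :
    mutualInfo (bernWeight p) (pipeChannel ν ε b σ) =
      (1 - ε) * pipeInfo ν b σ p * Real.log 2 := by
  have hlog : Real.log 2 ≠ 0 := (Real.log_pos one_lt_two).ne'
  have hinfo : pipeInfo ν b σ p * Real.log 2 = ∑ s, ν.real {z | σ z = s} *
      (Real.binEntropy (binConv p ((ν[|{z' | σ z' = s}]).real {z' | b z' = true})) -
        Real.binEntropy ((ν[|{z' | σ z' = s}]).real {z' | b z' = true})) := by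
    rw [← integral_comp_eq_sum ν σ (fun s =>
      Real.binEntropy (binConv p ((ν[|{z' | σ z' = s}]).real {z' | b z' = true})) -
        Real.binEntropy ((ν[|{z' | σ z' = s}]).real {z' | b z' = true})), pipeInfo,
      ← integral_mul_const]
    refine integral_congr_ae (ae_of_all _ fun z => ?_)
    simp only [binEnt]
    field_simp
  have hR : ∀ s, ν.real {z | σ z = s} =
      ν.real {z | σ z = s ∧ b z = false} + ν.real {z | σ z = s ∧ b z = true} := by
    intro s
    rw [← measureReal_union _ MeasurableSet.of_discrete]
    · congr 1
      ext z
      cases h : b z <;> simp [h]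
    · exact Set.disjoint_left.2 fun z hz hz' => by simp [hz.2] at hz'
  have hα : ∀ s, (ν[|{z' | σ z' = s}]).real {z' | b z' = true} =
      ν.real {z | σ z = s ∧ b z = true} /
        (ν.real {z | σ z = s ∧ b z = false} + ν.real {z | σ z = s ∧ b z = true}) := by
    intro s
    rw [← hR, measureReal_def, cond_apply MeasurableSet.of_discrete, ENNReal.toReal_mul,
      ENNReal.toReal_inv, div_eq_inv_mul]
    rfl
  rw [mul_assoc, hinfo, Finset.mul_sum, mutualInfo]
  simp only [Fintype.sum_bool, Fintype.sum_option, Fintype.sum_prod_type, bernWeight,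
    pipeChannel_none h0 h1, pipeChannel_some h0 h1, hα, hR, if_true, Bool.true_xor,
    Bool.false_xor, Bool.not_true, Bool.not_false, Bool.false_eq_true, if_false]
  -- Both inputs are erased with the same probability, so the likelihood ratio of an erasure is `1`,
  -- or `0 / 0 = 0` when `ε = 0`; either way its logarithm is `0`.
  have hnone : Real.log (ε / (p * ε + (1 - p) * ε)) = 0 := by
    rw [← add_mul, add_sub_cancel, one_mul]
    by_cases h : ε = 0 <;> simp [h]
  simp only [hnone, mul_zero, zero_add, ← Finset.sum_add_distrib]
  refine Finset.sum_congr rfl fun s _ => ?_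
  rw [← scaled_binary_information_terms hp0 hp1 measureReal_nonneg measureReal_nonneg]

theorem continuous_pipeInfo [Fintype Z] (ν : Measure Z) [IsProbabilityMeasure ν] (b : Z → Bool) (σ : Z → S) :
    Continuous (pipeInfo ν b σ) := by
  unfold pipeInfo
  simp only [integral_fintype Integrable.of_finite]
  unfold binEnt binConv
  have := Real.binEntropy_continuous
  fun_prop

/-- Links the error event under the block law to the finite sums of Feinstein's lemma: a prescribed
output block is a product event. -/
theorem pi_real_ne_eq_sum {X Y Ω T : Type*} [Fintype Y] [MeasurableSpace Ω] [Fintype Ω]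
    [DiscreteMeasurableSpace Ω] [DecidableEq T]
    (μ : Measure Ω) [IsProbabilityMeasure μ] (g : X → Ω → Y) {n : ℕ}
    (x : Fin n → X) (D : (Fin n → Y) → T) (j : T) :
    (Measure.pi fun _ : Fin n => μ).real {ω | D (fun t => g (x t) (ω t)) ≠ j} =
      ∑ y with D y ≠ j, ∏ t, μ.real {ω | g (x t) ω = y t} := by
  have h := sum_measureReal_preimage_singleton (μ := Measure.pi fun _ : Fin n => μ)
    (Finset.univ.filter fun y => D y ≠ j)
    (f := fun ω t => g (x t) (ω t)) (fun _ _ => MeasurableSet.of_discrete)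
  have h' : (fun (ω : Fin n → Ω) t => g (x t) (ω t)) ⁻¹' ↑(Finset.univ.filter fun y => D y ≠ j) =
      {ω | D (fun t => g (x t) (ω t)) ≠ j} := by
    ext; simp
  rw [h'] at h
  rw [← h]
  refine Finset.sum_congr rfl fun y _ => ?_
  have : (fun (ω : Fin n → Ω) t => g (x t) (ω t)) ⁻¹' {y} =
      Set.univ.pi fun t => {ω | g (x t) ω = y t} := by
    ext; simp [funext_iff]
  rw [this, measureReal_def, Measure.pi_pi, ENNReal.toReal_prod]
  rfl

end Pipe

/-- Concavity: `binConv p a` is a convex combination of `a` and `1 - a`, which have equal entropy.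
-/
theorem binEntropy_le_binEntropy_binConv {p a : ℝ} (hp0 : 0 ≤ p) (hp1 : p ≤ 1) (ha0 : 0 ≤ a)
    (ha1 : a ≤ 1) : Real.binEntropy a ≤ Real.binEntropy (binConv p a) := by
  have h := Real.strictConcave_binEntropy.concaveOn.2
    (show 1 - a ∈ Set.Icc (0 : ℝ) 1 from ⟨by linarith, by linarith⟩)
    (show a ∈ Set.Icc (0 : ℝ) 1 from ⟨ha0, ha1⟩) hp0 (sub_nonneg.2 hp1) (by ring)
  simp only [smul_eq_mul, Real.binEntropy_one_sub] at h
  unfold binConv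
  linarith

section Pipe

variable {Z S : Type*} [MeasurableSpace Z]

theorem pipeInfo_nonneg (ν : Measure Z) [IsProbabilityMeasure ν] (b : Z → Bool) (σ : Z → S) {p : ℝ}
    (hp0 : 0 ≤ p) (hp1 : p ≤ 1) : 0 ≤ pipeInfo ν b σ p := by
  refine integral_nonneg fun z => ?_
  simp only [binEnt, Pi.zero_apply, sub_nonneg]
  have hlog := Real.log_pos one_lt_two
  refine div_le_div_of_nonneg_right ?_ hlog.le
  exact binEntropy_le_binEntropy_binConv hp0 hp1 measureReal_nonneg measureReal_le_one

theorem pipeInfo_zero (ν : Measure Z) (b : Z → Bool) (σ : Z → S) : pipeInfo ν b σ 0 = 0 := by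
  simp [pipeInfo, binConv]

/-- The code of a single bit-pipe: its codewords have a fraction of ones in `[p - δ, p]`. -/
theorem eventually_exists_pipe_code [Fintype Z] [DiscreteMeasurableSpace Z] [Fintype S]
    [MeasurableSpace S] [DiscreteMeasurableSpace S] (ν : Measure Z) [IsProbabilityMeasure ν]
    {ε : ℝ} (h0 : 0 ≤ ε) (h1 : ε ≤ 1) (b : Z → Bool) (σ : Z → S) {p : ℝ} (hp0 : 0 ≤ p)
    (hp1 : p ≤ 1) {δ : ℝ} (hδ : 0 < δ) :
    ∀ᶠ n : ℕ in atTop, ∃ M : ℕ, (1 - ε) * pipeInfo ν b σ p - δ ≤ Real.logb 2 M / n ∧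
      ∃ (c : Fin M → Fin n → Bool) (D : (Fin n → Option (Bool × S)) → Fin M), ∀ j,
        ((Finset.univ.filter fun t => c j t = true).card : ℝ) / n ≤ p ∧
        p - δ ≤ ((Finset.univ.filter fun t => c j t = true).card : ℝ) / n ∧
        (Measure.pi fun _ : Fin n => ν.prod (erasureLaw ε)).real
          {ω | D (fun t => pipeOut b σ (c j t) (ω t)) ≠ j} ≤ δ := by
  classical
  have := isProbabilityMeasure_erasureLaw h0 h1
  -- For `p = 0` there is no room to aim lower; one all-zero codeword suffices, as the information
  -- is `0`.
  rcases hp0.eq_or_lt with rfl | hp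
  · refine Eventually.of_forall fun n => ⟨1, ?_, fun _ _ => false, fun _ => 0, fun j => ?_⟩
    · simp [pipeInfo_zero, hδ.le]
    · simp [Subsingleton.elim (0 : Fin 1) j, hδ.le]
  have hlog : 0 < Real.log 2 := Real.log_pos one_lt_two
  have hcont : Continuous fun p => (1 - ε) * pipeInfo ν b σ p :=
    continuous_const.mul (continuous_pipeInfo ν b σ)
  obtain ⟨ρ, hρ, hcont⟩ := Metric.continuous_iff.1 hcont p (δ / 2) (half_pos hδ)
  -- The code aims at `p - τ` with deviation below `τ`, so the fraction of ones lies between `p - 2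
  -- * τ ≥ p - δ` and `p`. The bound by `ρ / 2` keeps the loss of information below `δ / 2`.
  set τ := min (ρ / 2) (min p (δ / 2)) with hτ
  have hτ0 : 0 < τ := lt_min (half_pos hρ) (lt_min hp (half_pos hδ))
  have hτρ : τ < ρ := (min_le_left _ _).trans_lt (half_lt_self hρ)
  have hτp : τ ≤ p := (min_le_right _ _).trans (min_le_left _ _)
  have hτδ : τ ≤ δ / 2 := (min_le_right _ _).trans (min_le_right _ _)
  have hinfo := hcont (p - τ) (by simpa [Real.dist_eq, abs_of_pos hτ0] using hτρ)
  rw [Real.dist_eq, abs_lt] at hinfo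
  have hδ' : 0 < min τ (δ / 2 * Real.log 2) := lt_min hτ0 (by positivity)
  have hP : ∀ x, 0 ≤ bernWeight (p - τ) x := by
    intro x; cases x <;> simp [bernWeight] <;> linarith
  filter_upwards [eventually_gt_atTop 0, eventually_exists_code (W := pipeChannel ν ε b σ) hP
    (by simp [bernWeight]) (fun _ _ => measureReal_nonneg) (sum_pipeChannel ν h0 h1 b σ)
    (fun x => if x then 1 else 0) hδ'] with n hn hcode
  obtain ⟨M, hM0, hM, c, D, hcD⟩ := hcode
  have hn' : (0 : ℝ) < n := by exact_mod_cast hn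
  rw [mutualInfo_pipeChannel ν h0 h1 b σ (by linarith) (by linarith)] at hM
  refine ⟨M, ?_, c, D, fun j => ?_⟩
  · rw [le_div_iff₀ hn', Real.logb, le_div_iff₀ hlog]
    refine le_trans ?_ hM
    have h2 : ((1 - ε) * pipeInfo ν b σ p - δ) * Real.log 2 ≤
        (1 - ε) * pipeInfo ν b σ (p - τ) * Real.log 2 - min τ (δ / 2 * Real.log 2) := by
      have h3 := mul_lt_mul_of_pos_right hinfo.1 hlog
      have h4 := min_le_right τ (δ / 2 * Real.log 2)
      linarith
    have h5 := mul_le_mul_of_nonneg_left h2 hn'.le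
    linarith
  · obtain ⟨hf, herr⟩ := hcD j
    have hcount : ∑ t, (if c j t then (1 : ℝ) else 0) =
        (Finset.univ.filter fun t => c j t = true).card := by simp
    have hmean : ∑ x, bernWeight (p - τ) x * (if x then (1 : ℝ) else 0) = p - τ := by
      simp [bernWeight]
    rw [hcount, hmean, abs_lt] at hf
    have hmin : n * min τ (δ / 2 * Real.log 2) ≤ n * τ :=
      mul_le_mul_of_nonneg_left (min_le_left _ _) hn'.le
    have hnτ : n * τ ≤ n * (δ / 2) := mul_le_mul_of_nonneg_left hτδ hn'.le
    refine ⟨?_, ?_, ?_⟩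
    · rw [div_le_iff₀ hn']; linarith
    · rw [le_div_iff₀ hn']; linarith
    · rw [pi_real_ne_eq_sum (ν.prod (erasureLaw ε)) (pipeOut b σ)]
      refine le_trans ?_ (herr.trans ((min_le_left _ _).trans (hτδ.trans (half_le_self hδ.le))))
      refine le_of_eq (Finset.sum_congr ?_ fun _ _ => rfl)
      ext; simp

end Pipe

/-! ### Successive decoding -/

namespace SDScheme

variable {N : ℕ} {𝒜 : Fin N → Finset ℤ} {n : ℕ}

/-- The decision on bit-pipe `i` when the noise bits of the lower bit-pipes and the carry-over are
known. -/
def genieDecision (c : SDScheme 𝒜 n) (m : ∀ i, Fin (c.M i)) (ω : Fin n → (Fin N → Bool) × Bool)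
    (i : Fin N) : Fin (c.M i) :=
  c.dec i (fun t => if (ω t).2 then none else some (c.enc i (m i) t ^^ (ω t).1 i))
    (fun t => if (ω t).2 then none else some (stateVec (𝒜 i) (ω t).1))

theorem decision_eq_genieDecision (c : SDScheme 𝒜 n) (h𝒜 : ∀ i, ∀ a ∈ 𝒜 i, a < (i : ℤ))
    (m : ∀ i, Fin (c.M i)) (ω : Fin n → (Fin N → Bool) × Bool) (i : Fin N)
    (z : Fin n → ℤ → Bool) (w : Fin n → Bool)
    (hz : ∀ t, (ω t).2 = false → ∀ j : ℤ, j < i → z t j = extBit (ω t).1 j)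
    (hw : ∀ t, (ω t).2 = false → w t = carryOver (c.inputBits m t) (ω t).1 i) :
    c.decision (c.output m ω) i z w = c.genieDecision m ω i := by
  unfold decision genieDecision
  congr 1
  · funext t
    cases h : (ω t).2
    · simp [output, vbcErasedOut, vbcOut, h, hw t h, inputBits]
    · simp [output, vbcErasedOut, h]
  · funext t
    cases h : (ω t).2
    · simp only [output, vbcErasedOut, h, Bool.false_eq_true, if_false, Option.map_some]
      congr 1
      funext a
      exact hz t h a (h𝒜 i a a.2)
    · simp [output, vbcErasedOut, h]

/-- By induction on the pipe, correct reconstructions make the real decision equal to the genie's,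
hence correct, and this yields the next noise bit and carry. The induction covers all unerased times
at once, since each decision uses the whole block. -/
theorem receiver_eq (c : SDScheme 𝒜 n) (h𝒜 : ∀ i, ∀ a ∈ 𝒜 i, a < (i : ℤ))
    (m : ∀ i, Fin (c.M i)) (ω : Fin n → (Fin N → Bool) × Bool)
    (h : ∀ i, c.genieDecision m ω i = m i) (k : ℕ) (hk : k ≤ N) (t : Fin n)
    (ht : (ω t).2 = false) :
    (∀ j : ℤ, j < k → (c.receiver (c.output m ω) k).1 t j = extBit (ω t).1 j) ∧
      (c.receiver (c.output m ω) k).2 t = carryOver (c.inputBits m t) (ω t).1 k := by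
  induction k generalizing t with
  | zero =>
    refine ⟨fun j hj => ?_, rfl⟩
    have : ¬ (0 ≤ j ∧ j < N) := fun h => by simp at hj; omega
    simp [receiver, extBit, this]
  | succ k ih =>
    have hkN : k < N := hk
    have hdec : c.decision (c.output m ω) ⟨k, hkN⟩ (c.receiver (c.output m ω) k).1
        (c.receiver (c.output m ω) k).2 = m ⟨k, hkN⟩ := by
      rw [decision_eq_genieDecision c h𝒜 m ω ⟨k, hkN⟩ _ _
        (fun t ht => (ih hkN.le t ht).1) (fun t ht => (ih hkN.le t ht).2), h]
    have hzk : ((c.output m ω t).elim false fun v =>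
        (v ⟨k, hkN⟩ ^^ (c.receiver (c.output m ω) k).2 t) ^^ c.enc ⟨k, hkN⟩ (m ⟨k, hkN⟩) t) =
        (ω t).1 ⟨k, hkN⟩ := by
      simp only [output, vbcErasedOut, ht, vbcOut, (ih hkN.le t ht).2, inputBits,
        Bool.false_eq_true, if_false, Option.elim_some]
      generalize c.enc ⟨k, hkN⟩ (m ⟨k, hkN⟩) t = x
      generalize carryOver _ _ k = w
      generalize (ω t).1 ⟨k, hkN⟩ = z
      cases x <;> cases w <;> cases z <;> rfl
    simp only [receiver, dif_pos hkN, hdec, hzk, carryOver]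
    refine ⟨fun j hj => ?_, ?_⟩
    · rcases (show j ≤ k by push_cast at hj; omega).eq_or_lt with rfl | hj'
      · rw [Function.update_self]
        simp [extBit, hkN]
      · rw [Function.update_of_ne hj'.ne]
        exact (ih hkN.le t ht).1 j hj'
    · rw [(ih hkN.le t ht).2]
      rfl

theorem decoded_eq (c : SDScheme 𝒜 n) (h𝒜 : ∀ i, ∀ a ∈ 𝒜 i, a < (i : ℤ))
    (m : ∀ i, Fin (c.M i)) (ω : Fin n → (Fin N → Bool) × Bool)
    (h : ∀ i, c.genieDecision m ω i = m i) (i : Fin N) : c.decoded (c.output m ω) i = m i := by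
  rw [decoded, decision_eq_genieDecision c h𝒜 m ω i _ _
    (fun t ht => (receiver_eq c h𝒜 m ω h i i.2.le t ht).1)
    (fun t ht => (receiver_eq c h𝒜 m ω h i i.2.le t ht).2), h]

/-- The state-assisted scheme that is made of one code for each bit-pipe. -/
def ofPipeCodes (𝒜 : Fin N → Finset ℤ) (M : Fin N → ℕ) (enc : ∀ i, Fin (M i) → Fin n → Bool)
    (D : ∀ i, (Fin n → Option (Bool × (𝒜 i → Bool))) → Fin (M i)) : SDScheme 𝒜 n where
  M := M
  enc := enc
  -- Output and state are erased at the same times, so pairing the two streams loses nothing.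
  dec i y s := D i fun t => (y t).bind fun a => (s t).map fun u => (a, u)

theorem genieDecision_ofPipeCodes (M : Fin N → ℕ) (enc : ∀ i, Fin (M i) → Fin n → Bool)
    (D : ∀ i, (Fin n → Option (Bool × (𝒜 i → Bool))) → Fin (M i)) (m : ∀ i, Fin (M i))
    (ω : Fin n → (Fin N → Bool) × Bool) (i : Fin N) :
    (ofPipeCodes 𝒜 M enc D).genieDecision m ω i =
      D i fun t => pipeOut (fun z => z i) (stateVec (𝒜 i)) (enc i (m i) t) (ω t) := by
  unfold genieDecision ofPipeCodes
  simp only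
  congr 1
  funext t
  cases h : (ω t).2 <;> simp [pipeOut, h]

end SDScheme

/-! ### The noise law and the erasure probability -/

theorem isProbabilityMeasure_noiseLaw {A β γ : ℝ} (hA : 0 < A) (hβ : 0 < β) (hγ : 0 < γ) :
    IsProbabilityMeasure (noiseLaw A β γ) := by
  -- A nonempty open interval in the support gives it positive Gaussian measure, so conditioning is
  -- legitimate.
  have hsub : Set.Ioo (-β) (A + β) ⊆ noiseSupport A β γ := by
    intro z hz
    have h1 : 0 < γ * (z + β) := mul_pos hγ (by linarith [hz.1])
    have h2 : γ * (z + β) < γ * (A + 2 * β) := mul_lt_mul_of_pos_left (by linarith [hz.2]) hγ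
    have h3 : (0 : ℝ) ≤ ⌈γ * A⌉ := (mul_pos hγ hA).le.trans (Int.le_ceil _)
    exact ⟨by linarith, h2.trans_le (Int.le_ceil _)⟩
  have hne : gaussianReal 0 1 (noiseSupport A β γ) ≠ 0 := by
    intro h
    have h1 := gaussianReal_absolutelyContinuous' 0 one_ne_zero (measure_mono_null hsub h)
    rw [Real.volume_Ioo, ENNReal.ofReal_eq_zero] at h1
    linarith
  have := cond_isProbabilityMeasure hne
  exact Measure.isProbabilityMeasure_map (measurable_noiseBits _ _ _).aemeasurable

/-- For `β ≥ 0` the tail is at most the half-line integral, so `Q(β) ≤ 1/2`. -/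
theorem epsBar_le_one {β : ℝ} (hβ : 0 ≤ β) : epsBar β ≤ 1 := by
  have hint : Integrable fun u : ℝ => Real.exp (-u ^ 2 / 2) := by
    have := integrable_exp_neg_mul_sq (b := 1 / 2) (by norm_num)
    refine this.congr (ae_of_all _ fun u => ?_)
    simp only
    congr 1; ring
  have h1 : ∫ u in Set.Ioi β, Real.exp (-u ^ 2 / 2) ≤ ∫ u in Set.Ioi (0 : ℝ), Real.exp (-u ^ 2 / 2) :=
    setIntegral_mono_set hint.integrableOn (ae_of_all _ fun u => (Real.exp_pos _).le)
      (Set.Ioi_subset_Ioi hβ).eventuallyLE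
  have h2 : ∫ u in Set.Ioi (0 : ℝ), Real.exp (-u ^ 2 / 2) = Real.sqrt (2 * Real.pi) / 2 := by
    have h := integral_gaussian_Ioi (1 / 2)
    rw [show Real.pi / (1 / 2) = 2 * Real.pi by ring] at h
    rw [← h]
    congr 1
    ext u; congr 1; ring
  rw [h2] at h1
  have hs : 0 < Real.sqrt (2 * Real.pi) := by positivity
  unfold epsBar gaussQ
  calc 2 * (1 / Real.sqrt (2 * Real.pi) * ∫ u in Set.Ioi β, Real.exp (-u ^ 2 / 2))
      ≤ 2 * (1 / Real.sqrt (2 * Real.pi) * (Real.sqrt (2 * Real.pi) / 2)) := by gcongr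
    _ = 1 := by field_simp

/-! ### Existence of the maximum -/

theorem isCompact_feasibleInputs (A E β γ : ℝ) : IsCompact (feasibleInputs A E β γ) := by
  set N := numPipes A β γ
  -- Requiring only that the support of `p` lie in `T` is a closed condition. There are finitely
  -- many `T`, and a smaller support only relaxes the peak constraint.
  have h : feasibleInputs A E β γ = ⋃ T ∈ {T : Finset (Fin N) | ∑ i ∈ T, (2 : ℝ) ^ (i : ℕ) ≤ γ * A},
      (Set.univ.pi (fun _ : Fin N => Set.Icc (0 : ℝ) 1)) ∩
        ({p | ∀ i, i ∉ T → p i = 0} ∩ {p | ∑ i, p i * (2 : ℝ) ^ (i : ℕ) ≤ γ * E}) := by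
    have hsum : ∀ p : Fin N → ℝ, ∑ i with p i ≠ 0, p i * (2 : ℝ) ^ (i : ℕ) =
        ∑ i, p i * (2 : ℝ) ^ (i : ℕ) := by
      intro p
      rw [Finset.sum_filter]
      refine Finset.sum_congr rfl fun i _ => ?_
      by_cases hi : p i = 0 <;> simp [hi]
    ext p
    simp only [feasibleInputs, Set.mem_iUnion, Set.mem_inter_iff, Set.mem_pi, Set.mem_univ,
      true_implies, Set.mem_Icc, Set.mem_ofPred_eq, exists_prop]
    constructor
    · rintro ⟨h1, h2, h3⟩
      exact ⟨_, h2, h1, fun i hi => by simpa using hi, (hsum p).symm.trans_le h3⟩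
    · rintro ⟨T, h2, h1, h4, h3⟩
      refine ⟨h1, le_trans (Finset.sum_le_sum_of_subset_of_nonneg ?_ fun _ _ _ => by positivity) h2,
        (hsum p).trans_le h3⟩
      intro i hi
      by_contra hiT
      exact (Finset.mem_filter.1 hi).2 (h4 i hiT)
  rw [h]
  refine (Set.toFinite _).isCompact_biUnion fun T _ => ?_
  refine (isCompact_univ_pi fun _ => isCompact_Icc).inter_right (IsClosed.inter ?_ ?_)
  · simp only [Set.ofPred_forall]
    refine isClosed_iInter fun i => isClosed_iInter fun _ => ?_
    exact isClosed_eq (continuous_apply i) continuous_const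
  · exact isClosed_le (by fun_prop) continuous_const

theorem sdSum_eq_sum_pipeInfo (A β γ : ℝ) (𝒜 : Fin (numPipes A β γ) → Finset ℤ)
    (p : Fin (numPipes A β γ) → ℝ) : sdSum A β γ 𝒜 p =
      ∑ i, pipeInfo (noiseLaw A β γ) (fun z => z i) (stateVec (𝒜 i)) (p i) := rfl

theorem exists_isMaxOn_sdSum {A E β γ : ℝ} (hA : 0 < A) (hE : 0 < E) (hβ : 0 < β) (hγ : 0 < γ)
    (𝒜 : Fin (numPipes A β γ) → Finset ℤ) :
    ∃ p ∈ feasibleInputs A E β γ, IsMaxOn (sdSum A β γ 𝒜) (feasibleInputs A E β γ) p := by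
  have := isProbabilityMeasure_noiseLaw hA hβ hγ
  refine (isCompact_feasibleInputs A E β γ).exists_isMaxOn ⟨0, ?_⟩ ?_
  · simp [feasibleInputs, (mul_pos hγ hA).le, (mul_pos hγ hE).le]
  · refine Continuous.continuousOn ?_
    simp only [funext (sdSum_eq_sum_pipeInfo A β γ 𝒜)]
    exact continuous_finsetSum _ fun i _ =>
      (continuous_pipeInfo (noiseLaw A β γ) (fun z => z i) (stateVec (𝒜 i))).comp
        (continuous_apply i)

/-! ### Achievability -/

theorem admissible_of_frequency_le {A E β γ : ℝ} (hγ : 0 < γ) {n : ℕ}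
    {𝒜 : Fin (numPipes A β γ) → Finset ℤ} {p : Fin (numPipes A β γ) → ℝ}
    (hp : p ∈ feasibleInputs A E β γ) {δ : ℝ} (hδ : 0 < δ) (hn : 0 < n) (c : SDScheme 𝒜 n)
    (hle : ∀ i m, ((Finset.univ.filter fun t => c.enc i m t = true).card : ℝ) / n ≤ p i)
    (hge : ∀ i m, p i - δ ≤ ((Finset.univ.filter fun t => c.enc i m t = true).card : ℝ) / n) :
    c.Admissible A E γ p δ := by
  obtain ⟨hp01, hpA, hpE⟩ := hp
  have hn' : (0 : ℝ) < n := by exact_mod_cast hn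
  -- The one-sided bound `hle` forces silence on these pipes, so only pipes with `p i ≠ 0` count
  -- towards the peak.
  have hzero : ∀ i, p i = 0 → ∀ m t, c.enc i m t = false := by
    intro i hi m t
    have h1 := hle i m
    rw [hi, div_le_iff₀ hn', zero_mul] at h1
    have h2 : (Finset.univ.filter fun t => c.enc i m t = true).card = 0 := by
      exact_mod_cast le_antisymm h1 (Nat.cast_nonneg _)
    rw [Finset.card_eq_zero, Finset.filter_eq_empty_iff] at h2
    simpa using h2 (Finset.mem_univ t)
  refine ⟨hzero, fun i m => ?_, fun m t => ?_, fun m => ?_⟩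
  · rw [abs_le]
    constructor <;> linarith [hle i m, hge i m]
  · rw [SDScheme.intensity, div_le_iff₀ hγ, mul_comm A]
    refine le_trans ?_ hpA
    rw [Finset.sum_filter]
    refine Finset.sum_le_sum fun i _ => ?_
    by_cases hi : p i = 0
    · simp [SDScheme.inputBits, hzero i hi, hi]
    · rw [if_pos hi]
      split_ifs
      · exact le_rfl
      · positivity
  · rw [div_le_iff₀ hn']
    simp only [SDScheme.intensity, ← Finset.sum_div]
    rw [div_le_iff₀ hγ, Finset.sum_comm]
    have h1 : ∀ i, ∑ t, (if c.inputBits m t i then (2 : ℝ) ^ (i : ℕ) else 0) ≤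
        n * (p i * 2 ^ (i : ℕ)) := by
      intro i
      have h2 := hle i (m i)
      rw [div_le_iff₀ hn'] at h2
      rw [← Finset.sum_filter, Finset.sum_const, nsmul_eq_mul]
      have h3 := mul_le_mul_of_nonneg_right h2 (show (0 : ℝ) ≤ 2 ^ (i : ℕ) by positivity)
      exact h3.trans_eq (by ring)
    refine (Finset.sum_le_sum fun i _ => h1 i).trans ?_
    rw [← Finset.mul_sum]
    have h4 : ∑ i, p i * (2 : ℝ) ^ (i : ℕ) ≤ γ * E := by
      refine le_of_eq_of_le ?_ hpE
      rw [Finset.sum_filter]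
      refine Finset.sum_congr rfl fun i _ => ?_
      by_cases hi : p i = 0 <;> simp [hi]
    have := mul_le_mul_of_nonneg_left h4 hn'.le
    linarith

theorem sdAchieves_of_mem_feasibleInputs {A E β γ ε : ℝ} (hA : 0 < A) (hβ : 0 < β) (hγ : 0 < γ)
    (hε0 : 0 ≤ ε) (hε1 : ε ≤ 1) {𝒜 : Fin (numPipes A β γ) → Finset ℤ}
    (h𝒜 : ∀ i, ∀ a ∈ 𝒜 i, a < (i : ℤ)) {p : Fin (numPipes A β γ) → ℝ}
    (hp : p ∈ feasibleInputs A E β γ) :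
    SDAchieves A E β γ ε 𝒜 p ((1 - ε) * sdSum A β γ 𝒜 p) := by
  intro δ hδ
  have hν := isProbabilityMeasure_noiseLaw hA hβ hγ
  have := isProbabilityMeasure_erasureLaw hε0 hε1
  -- Rate losses and error probabilities add up over the pipes; the `+ 1` keeps the denominator
  -- positive and gives `δ' ≤ δ`.
  set δ' := δ / (numPipes A β γ + 1) with hδ'
  have hδ'0 : 0 < δ' := by positivity
  have hNδ : numPipes A β γ * δ' ≤ δ := by
    rw [hδ', mul_div_assoc', div_le_iff₀ (by positivity)]
    linarith
  have hδ'δ : δ' ≤ δ := div_le_self hδ.le (by linarith [Nat.cast_nonneg (α := ℝ) (numPipes A β γ)])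
  have hcodes := eventually_all.2 fun i => eventually_exists_pipe_code (noiseLaw A β γ) hε0 hε1
    (fun z => z i) (stateVec (𝒜 i)) (hp.1 i).1 (hp.1 i).2 hδ'0
  filter_upwards [eventually_gt_atTop 0, hcodes] with n hn hcode
  choose M hM enc D hcD using hcode
  refine ⟨SDScheme.ofPipeCodes 𝒜 M enc D, ?_, ?_, fun m => ?_⟩
  · exact admissible_of_frequency_le hγ hp hδ hn _ (fun i m => (hcD i m).1)
      (fun i m => le_trans (by linarith) (hcD i m).2.1)
  · rw [sdSum_eq_sum_pipeInfo, Finset.mul_sum, Finset.sum_div]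
    have h := Finset.sum_le_sum fun i (_ : i ∈ Finset.univ) => hM i
    rw [Finset.sum_sub_distrib, Finset.sum_const, Finset.card_univ, Fintype.card_fin,
      nsmul_eq_mul] at h
    exact le_trans (by linarith) h
  · have hsub : {ω : Fin n → (Fin (numPipes A β γ) → Bool) × Bool | ∃ i, (SDScheme.ofPipeCodes 𝒜 M enc D).decoded
        ((SDScheme.ofPipeCodes 𝒜 M enc D).output m ω) i ≠ m i} ⊆
        ⋃ i, {ω | D i (fun t => pipeOut (fun z => z i) (stateVec (𝒜 i)) (enc i (m i) t) (ω t)) ≠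
          m i} := by
      intro ω hω
      by_contra hcon
      simp only [Set.mem_iUnion, Set.mem_ofPred_eq, not_exists] at hcon
      obtain ⟨i, hi⟩ := hω
      exact hi (SDScheme.decoded_eq _ h𝒜 m ω
        (fun i => (SDScheme.genieDecision_ofPipeCodes M enc D m ω i).trans (not_not.1 (hcon i))) i)
    calc sdErrorProb A β γ ε (SDScheme.ofPipeCodes 𝒜 M enc D) m
        ≤ (blockLaw A β γ ε n).real (⋃ i, {ω | D i (fun t =>
            pipeOut (fun z => z i) (stateVec (𝒜 i)) (enc i (m i) t) (ω t)) ≠ m i}) := by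
          unfold sdErrorProb blockLaw
          exact measureReal_mono hsub
      _ ≤ ∑ i, (blockLaw A β γ ε n).real {ω | D i (fun t =>
            pipeOut (fun z => z i) (stateVec (𝒜 i)) (enc i (m i) t) (ω t)) ≠ m i} :=
          measureReal_iUnion_fintype_le _
      _ ≤ ∑ _i : Fin (numPipes A β γ), δ' := Finset.sum_le_sum fun i _ => (hcD i (m i)).2.2
      _ ≤ δ := by simpa using hNδ

theorem theorem3 (A E β γ : ℝ) (hA : 0 < A) (hE : 0 < E) (hβ : 0 < β) (hγ : 0 < γ)
    (q : ℕ) (hq : 1 ≤ q) (hqN : q ≤ numPipes A β γ - 1)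
    (𝒜 : Fin (numPipes A β γ) → Finset ℤ)
    (h𝒜 : ∀ i, (𝒜 i).card = q ∧
      𝒜 i ⊆ Finset.Icc ((i : ℤ) - (numPipes A β γ : ℤ) + 1) ((i : ℤ) - 1)) :
    ∃ p ∈ feasibleInputs A E β γ,
      IsMaxOn (sdSum A β γ 𝒜) (feasibleInputs A E β γ) p ∧
      ∀ ε : ℝ, 0 ≤ ε → ε ≤ epsBar β →
        SDAchieves A E β γ ε 𝒜 p ((1 - epsBar β) * sdSum A β γ 𝒜 p) := by
  obtain ⟨p, hp, hmax⟩ := exists_isMaxOn_sdSum hA hE hβ hγ 𝒜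
  refine ⟨p, hp, hmax, fun ε hε0 hε δ hδ => ?_⟩
  have hν := isProbabilityMeasure_noiseLaw hA hβ hγ
  have hlt : ∀ i, ∀ a ∈ 𝒜 i, a < (i : ℤ) := fun i a ha => by
    have := (Finset.mem_Icc.1 ((h𝒜 i).2 ha)).2
    omega
  have hnonneg : 0 ≤ sdSum A β γ 𝒜 p := by
    rw [sdSum_eq_sum_pipeInfo]
    exact Finset.sum_nonneg fun i _ => pipeInfo_nonneg _ _ _ (hp.1 i).1 (hp.1 i).2
  have hrate : (1 - epsBar β) * sdSum A β γ 𝒜 p ≤ (1 - ε) * sdSum A β γ 𝒜 p :=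
    mul_le_mul_of_nonneg_right (by linarith) hnonneg
  filter_upwards [sdAchieves_of_mem_feasibleInputs hA hβ hγ hε0 (hε.trans (epsBar_le_one hβ.le))
    hlt hp δ hδ] with n hc
  obtain ⟨c, hadm, hR, herr⟩ := hc
  exact ⟨c, hadm, by linarith, herr⟩
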